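/- Let $d\ge 0$ be an integer. An affine semigroup in $\mathbb{Z}^d$ is a submonoid of $(\mathbb{Z}^d,+)$ generated by finitely many vectors. An affine stratification of a subset $W\subseteq\mathbb{Z}^d$ is a partition $W=W_1\uplus\cdots\uplus W_r$ ($r\ge 0$) into finitely many pairwise disjoint sets, each of which is a finitely generated module for an affine semigroup $A_i\subseteq\mathbb{Z}^d$; that is, $W_i=F_i+A_i$ for some finite set $F_i\subset\mathbb{Z}^d$. Theorem. If $A\subseteq\mathbb{Z}^d$ and $B\subseteq A$ both possess affine stratifications, then $A\setminus B$ possesses an affine stratification. -/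

import Mathlib

open scoped Pointwise

/-- An affine semigroup in `ℤ^d`: a submonoid `ℕ{a₁, …, aₙ}` generated by finitely many
integer vectors. -/
def IsAffineSemigroup {d : ℕ} (A : AddSubmonoid (Fin d → ℤ)) : Prop :=
  ∃ S : Finset (Fin d → ℤ), A = AddSubmonoid.closure (S : Set (Fin d → ℤ))

/-- `W` is a finitely generated module for the affine semigroup `A`: `W = F + A` for a finite
set `F ⊆ ℤ^d`. -/
def IsFGModuleFor {d : ℕ} (A : AddSubmonoid (Fin d → ℤ)) (W : Set (Fin d → ℤ)) : Prop :=
  ∃ F : Finset (Fin d → ℤ), W = (F : Set (Fin d → ℤ)) + (A : Set (Fin d → ℤ))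

/-- An affine stratification of `W ⊆ ℤ^d`: a partition of `W` into finitely many pairwise
disjoint sets, each of which is a finitely generated module for some affine semigroup. -/
structure AffineStratification {d : ℕ} (W : Set (Fin d → ℤ)) where
  /-- the number of parts -/
  r : ℕ
  /-- the parts -/
  part : Fin r → Set (Fin d → ℤ)
  /-- the affine semigroups acting on the parts -/
  semigroup : Fin r → AddSubmonoid (Fin d → ℤ)
  isAffineSemigroup : ∀ i, IsAffineSemigroup (semigroup i)
  isFGModuleFor : ∀ i, IsFGModuleFor (semigroup i) (part i)
  pairwise_disjoint : ∀ i j, i ≠ j → Disjoint (part i) (part j)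
  iUnion_part : ⋃ i, part i = W

variable {d : ℕ}

/-! Affine stratifications exist exactly for the sets cut out by finitely many congruences and
integral linear inequalities (`IsPresburger`), a class closed under Boolean operations. A stratified
set is semilinear, hence a finite union of sets `a + ℕt` with `t` independent; dual functionals
describe each of these by equations, inequalities and congruences. Conversely, such a set splits
into finitely many polyhedral pieces of residue classes, and Gordan's lemma applied to the
homogenised system makes each piece a finitely generated module. -/

lemma LinearIndepOn.int_of_nat {M : Type*} [AddCommGroup M] {t : Set M}
    (ht : LinearIndepOn ℕ id t) : LinearIndepOn ℤ id t := by
  rw [linearIndepOn_iff'']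
  intro s f hs _ heq i hi
  rw [linearIndepOn_iff_linearIndepOn_finset] at ht
  specialize ht s hs
  rw [linearIndepOn_finset_iffₛ] at ht
  -- The positive and negative parts of `f` give two natural combinations with equal sums.
  specialize ht (Int.toNat ∘ f) (Int.toNat ∘ (-·) ∘ f) ?_ i hi
  · rw [← sub_eq_zero, ← Finset.sum_sub_distrib, ← heq]
    refine Finset.sum_congr rfl fun j _ => ?_
    conv_rhs => rw [← (f j).toNat_sub_toNat_neg]
    simp only [sub_smul, natCast_zsmul, Function.comp_apply, id_eq]
  · rw [← (f i).toNat_sub_toNat_neg, sub_eq_zero, Int.natCast_inj]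
    simpa using ht

/-- An independent finite family of integer vectors has integral dual functionals, up to a common
positive factor. -/
lemma LinearIndepOn.exists_dual {t : Finset (Fin d → ℤ)}
    (ht : LinearIndepOn ℤ id (t : Set (Fin d → ℤ))) :
    ∃ D : ℕ, 0 < D ∧ ∃ l : t → ((Fin d → ℤ) →+ ℤ),
      ∀ i j : t, l i j = if i = j then (D : ℤ) else 0 := by
  classical
  let e : (Fin d → ℤ) →ₗ[ℤ] (Fin d → ℚ) :=
    ((Int.castAddHom ℚ).compLeft (Fin d)).toIntLinearMap
  have he : Function.Injective e := fun x y h => by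
    ext i
    simpa [e] using congr_fun h i
  have hi : LinearIndependent ℚ (fun i : t => e i) := by
    rw [← LinearIndependent.iff_fractionRing ℤ ℚ]
    exact LinearIndependent.map' ht e (LinearMap.ker_eq_bot.2 he)
  obtain ⟨g, hg⟩ := LinearMap.exists_leftInverse_of_injective _ (LinearMap.ker_eq_bot.2 hi)
  obtain ⟨b, hb⟩ := IsLocalization.exist_integer_multiples_of_finite (nonZeroDivisors ℤ)
    (fun p : t × Fin d => g (Pi.single p.2 1) p.1)
  choose z hz using hb
  have hb0 : (b : ℤ) ≠ 0 := nonZeroDivisors.coe_ne_zero b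
  -- The common denominator `b` may be negative; its sign is moved into the functionals.
  refine ⟨(b : ℤ).natAbs, Int.natAbs_pos.2 hb0, fun i =>
    { toFun := fun x => (b : ℤ).sign * ∑ k, z (i, k) * x k
      map_zero' := by simp
      map_add' := fun x y => by simp [mul_add, Finset.sum_add_distrib] }, fun i j => ?_⟩
  have key : ∀ x : Fin d → ℤ, ((∑ k, z (i, k) * x k : ℤ) : ℚ) = b * g (e x) i := by
    intro x
    have : e x = ∑ k, (x k : ℚ) • Pi.single k (1 : ℚ) := by
      ext k
      simp [e, Finset.sum_apply, Pi.single_apply]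
    rw [this, map_sum, Finsupp.finsetSum_apply, Finset.mul_sum, Int.cast_sum]
    refine Finset.sum_congr rfl fun k _ => ?_
    have := hz (i, k)
    simp only [algebraMap_int_eq, eq_intCast, zsmul_eq_mul] at this
    rw [Int.cast_mul, this, map_smul, Finsupp.smul_apply, smul_eq_mul]
    ring
  have hgj : g (e j) = Finsupp.single j 1 := by
    have := LinearMap.congr_fun hg (Finsupp.single j 1)
    simpa using this
  have h1 : (∑ k, z (i, k) * (j : Fin d → ℤ) k : ℤ) = if i = j then (b : ℤ) else 0 := by
    rw [← Int.cast_inj (α := ℚ), key j, hgj, Finsupp.single_apply]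
    by_cases hij : i = j
    · simp [hij]
    · simp [hij, Ne.symm hij]
  change (b : ℤ).sign * _ = _
  rw [h1]
  split_ifs
  · rw [Int.sign_mul_self, Int.natCast_natAbs]
  · simp

/-! ### Boolean algebra of Presburger sets -/

/-- Membership in `W` depends only on residues modulo a fixed integer and on the truth values of
finitely many linear inequalities. -/
def IsPresburger (W : Set (Fin d → ℤ)) : Prop :=
  ∃ N : ℕ, 0 < N ∧ ∃ H : Finset (((Fin d → ℤ) →+ ℤ) × ℤ), ∀ x y : Fin d → ℤ,
    (∀ i, (N : ℤ) ∣ y i - x i) → (∀ h ∈ H, h.2 ≤ h.1 x ↔ h.2 ≤ h.1 y) → x ∈ W → y ∈ W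

namespace IsPresburger

lemma univ : IsPresburger (Set.univ : Set (Fin d → ℤ)) :=
  ⟨1, one_pos, ∅, fun _ _ _ _ _ => trivial⟩

lemma compl {W : Set (Fin d → ℤ)} (h : IsPresburger W) : IsPresburger Wᶜ := by
  obtain ⟨N, hN, H, h⟩ := h
  refine ⟨N, hN, H, fun x y hxy hH hx hy => hx (h y x (fun i => ?_) (fun p hp => (hH p hp).symm) hy)⟩
  rw [dvd_sub_comm]
  exact hxy i

lemma inter {W₁ W₂ : Set (Fin d → ℤ)} (h₁ : IsPresburger W₁) (h₂ : IsPresburger W₂) :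
    IsPresburger (W₁ ∩ W₂) := by
  classical
  obtain ⟨N₁, hN₁, H₁, h₁⟩ := h₁
  obtain ⟨N₂, hN₂, H₂, h₂⟩ := h₂
  refine ⟨N₁ * N₂, Nat.mul_pos hN₁ hN₂, H₁ ∪ H₂, fun x y hxy hH hx => ⟨?_, ?_⟩⟩
  · exact h₁ x y (fun i => (Dvd.intro _ (by push_cast; rfl)).trans (hxy i))
      (fun p hp => hH p (Finset.mem_union_left _ hp)) hx.1
  · exact h₂ x y (fun i => (Dvd.intro_left _ (by push_cast; rfl)).trans (hxy i))
      (fun p hp => hH p (Finset.mem_union_right _ hp)) hx.2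

lemma union {W₁ W₂ : Set (Fin d → ℤ)} (h₁ : IsPresburger W₁) (h₂ : IsPresburger W₂) :
    IsPresburger (W₁ ∪ W₂) := by
  rw [← compl_compl (W₁ ∪ W₂), Set.compl_union]
  exact (h₁.compl.inter h₂.compl).compl

lemma sUnion {S : Set (Set (Fin d → ℤ))} (hS : S.Finite) (h : ∀ W ∈ S, IsPresburger W) :
    IsPresburger (⋃₀ S) := by
  induction S, hS using Set.Finite.induction_on with
  | empty => simpa using univ.compl
  | insert _ _ ih =>
    rw [Set.sUnion_insert]
    exact (h _ (Set.mem_insert _ _)).union (ih fun W hW => h W (Set.mem_insert_of_mem _ hW))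

lemma iInter {ι : Type*} [Finite ι] {W : ι → Set (Fin d → ℤ)} (h : ∀ i, IsPresburger (W i)) :
    IsPresburger (⋂ i, W i) := by
  rw [← compl_compl (⋂ i, W i), Set.compl_iInter, ← Set.sUnion_range]
  refine (sUnion (Set.finite_range _) ?_).compl
  rintro _ ⟨i, rfl⟩
  exact (h i).compl

lemma setOf_le (l : (Fin d → ℤ) →+ ℤ) (c : ℤ) : IsPresburger {x | c ≤ l x} :=
  ⟨1, one_pos, {(l, c)}, fun _ _ _ hH hx => (hH _ (Finset.mem_singleton_self _)).1 hx⟩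

lemma setOf_eq (l : (Fin d → ℤ) →+ ℤ) (c : ℤ) : IsPresburger {x | l x = c} := by
  convert! (setOf_le l c).inter (setOf_le (-l) (-c)) using 1
  ext x
  simp only [Set.mem_ofPred_eq, Set.mem_inter_iff, AddMonoidHom.neg_apply, neg_le_neg_iff]
  exact ⟨fun h => ⟨h.ge, h.le⟩, fun h => le_antisymm h.2 h.1⟩

lemma setOf_dvd {N : ℕ} (hN : 0 < N) (l : (Fin d → ℤ) →+ ℤ) (c : ℤ) :
    IsPresburger {x | (N : ℤ) ∣ l x - c} := by
  refine ⟨N, hN, ∅, fun x y hxy _ hx => ?_⟩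
  choose z hz using hxy
  have : l y - c = l x - c + N * l z := by
    rw [← sub_add_cancel y x, show y - x = (N : ℤ) • z from funext fun i => by simp [hz], map_add,
      map_zsmul, smul_eq_mul]
    ring
  rw [Set.mem_ofPred_eq, this]
  exact dvd_add hx (dvd_mul_right _ _)

end IsPresburger

lemma IsProperLinearSet.isPresburger {W : Set (Fin d → ℤ)} (h : IsProperLinearSet W) :
    IsPresburger W := by
  classical
  obtain ⟨a, t, ht, rfl⟩ := isProperLinearSet_iff.1 h
  obtain ⟨D, hD, l, hl⟩ := ht.int_of_nat.exists_dual
  have hD' : (D : ℤ) ≠ 0 := by exact_mod_cast hD.ne'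
  -- `m k x = m k a` for all `k` says `D(x - a) = ∑ l i (x - a) • i`, so `x - a` lies in the
  -- rational span of `t`. The remaining conditions make its coordinates `l i (x - a) / D` natural
  -- numbers.
  let m (k : Fin d) : (Fin d → ℤ) →+ ℤ :=
    D • Pi.evalAddMonoidHom _ k - ∑ i : t, (i : Fin d → ℤ) k • l i
  convert! (IsPresburger.iInter fun k => IsPresburger.setOf_eq (m k) (m k a)).inter
    (IsPresburger.iInter fun i => (IsPresburger.setOf_le (l i) (l i a)).inter
      (IsPresburger.setOf_dvd hD (l i) (l i a))) using 1
  ext x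
  have hm : ∀ k y, m k y = D * y k - ∑ i : t, (i : Fin d → ℤ) k * l i y := fun k y => by
    simp [m, AddMonoidHom.finsetSum_apply]
  have hmem : x ∈ a +ᵥ (AddSubmonoid.closure (t : Set (Fin d → ℤ)) : Set (Fin d → ℤ)) ↔
      ∃ n : t → ℕ, x = a + ∑ i : t, n i • (i : Fin d → ℤ) := by
    simp only [Set.mem_vadd_set, SetLike.mem_coe, AddSubmonoid.mem_closure_finset', vadd_eq_add,
      Finset.univ_eq_attach]
    constructor
    · rintro ⟨_, ⟨n, rfl⟩, rfl⟩
      exact ⟨n, rfl⟩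
    · rintro ⟨n, rfl⟩
      exact ⟨_, ⟨n, rfl⟩, rfl⟩
  rw [hmem]
  simp only [Set.mem_inter_iff, Set.mem_iInter, Set.mem_ofPred_eq]
  constructor
  · rintro ⟨n, rfl⟩
    have hln : ∀ i, l i (∑ j : t, n j • (j : Fin d → ℤ)) = D * n i := fun i => by
      simp only [map_sum, map_nsmul, hl]
      simp [mul_comm]
    refine ⟨fun k => ?_, fun i => ?_⟩
    · rw [map_add, add_eq_left, hm]
      simp only [hln, Finset.sum_apply, Pi.smul_apply, Finset.mul_sum, ← Finset.sum_sub_distrib]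
      refine Finset.sum_eq_zero fun i _ => ?_
      simp only [nsmul_eq_mul]
      ring
    · rw [map_add, hln, add_sub_cancel_left]
      exact ⟨le_add_of_nonneg_right (by positivity), dvd_mul_right _ _⟩
  · rintro ⟨h1, h2⟩
    choose n hn using fun i => (h2 i).2
    have hn0 : ∀ i, 0 ≤ n i := fun i => by
      have := (h2 i).1
      refine nonneg_of_mul_nonneg_right (a := (D : ℤ)) ?_ (by exact_mod_cast hD)
      rw [← hn]
      exact sub_nonneg.2 this
    refine ⟨fun i => (n i).toNat, funext fun k => mul_left_cancel₀ hD' ?_⟩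
    have := h1 k
    rw [hm, hm, sub_eq_sub_iff_sub_eq_sub, ← Finset.sum_sub_distrib] at this
    simp only [← mul_sub, hn] at this
    simp only [Pi.add_apply, Finset.sum_apply, Pi.smul_apply]
    rw [mul_add, Finset.mul_sum, ← sub_eq_iff_eq_add', ← mul_sub, this]
    refine Finset.sum_congr rfl fun i _ => ?_
    rw [nsmul_eq_mul, Int.toNat_of_nonneg (hn0 i)]
    ring

lemma IsSemilinearSet.isPresburger {W : Set (Fin d → ℤ)} (h : IsSemilinearSet W) :
    IsPresburger W := by
  obtain ⟨S, hS, hS', rfl⟩ := h.isProperSemilinearSet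
  exact .sUnion hS fun W hW => (hS' W hW).isPresburger

lemma AffineStratification.isPresburger {W : Set (Fin d → ℤ)} (s : AffineStratification W) :
    IsPresburger W := by
  rw [← s.iUnion_part]
  refine IsSemilinearSet.isPresburger (.iUnion fun i => ?_)
  obtain ⟨S, hS⟩ := s.isAffineSemigroup i
  obtain ⟨F, hF⟩ := s.isFGModuleFor i
  rw [hF, hS]
  exact (IsSemilinearSet.of_finite F.finite_toSet).add (.closure_finset S)

/-! ### Finite generation and the way back to stratifications -/

/-- **Gordan's lemma**: the equalizer of two homomorphisms from a finitely generated commutative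
monoid to a cancellative one is finitely generated. -/
lemma AddMonoidHom.fg_eqLocusM {M N : Type*} [AddCommMonoid M] [AddMonoid.FG M] [AddCommMonoid N]
    [IsCancelAdd N] (f g : M →+ N) : (f.eqLocusM g).FG := by
  obtain ⟨n, h, hh⟩ := AddSubmonoid.fg_iff_exists_fin_addMonoidHom.1 (AddMonoid.FG.fg_top (M := M))
  rw [AddMonoidHom.mrange_eq_top] at hh
  convert! (AddSubmonoid.fg_eqLocusM (f.comp h) (g.comp h)).map h using 1
  ext x
  constructor
  · intro hx
    obtain ⟨y, rfl⟩ := hh x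
    exact ⟨y, hx, rfl⟩
  · rintro ⟨y, hy, rfl⟩
    exact hy

/-- The degree one slice of a finitely generated monoid graded by `ℕ` is a finitely generated
module over the degree zero part. -/
lemma AddSubmonoid.FG.exists_isFGModuleFor {Q : AddSubmonoid ((Fin d → ℤ) × ℕ)} (hQ : Q.FG) :
    ∃ A, IsAffineSemigroup A ∧ IsFGModuleFor A {x | (x, 1) ∈ Q} := by
  classical
  obtain ⟨T, rfl⟩ := hQ
  set A := AddSubmonoid.closure
    (((T.filter fun p => p.2 = 0).image Prod.fst : Finset (Fin d → ℤ)) : Set (Fin d → ℤ)) with hA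
  have hAT : ∀ x ∈ A, (x, 0) ∈ AddSubmonoid.closure (T : Set ((Fin d → ℤ) × ℕ)) := by
    intro x hx
    induction hx using AddSubmonoid.closure_induction with
    | mem x hx =>
      simp only [Finset.coe_image, Set.mem_image, Finset.mem_coe, Finset.mem_filter] at hx
      obtain ⟨⟨y, s⟩, ⟨hy, rfl⟩, rfl⟩ := hx
      exact AddSubmonoid.subset_closure hy
    | zero => exact zero_mem _
    | add x y _ _ hx hy => simpa using add_mem hx hy
  set F := (T.filter fun p => p.2 = 1).image Prod.fst with hF
  have key : ∀ p ∈ AddSubmonoid.closure (T : Set ((Fin d → ℤ) × ℕ)),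
      (p.2 = 0 → p.1 ∈ A) ∧ (p.2 = 1 → p.1 ∈ (F : Set (Fin d → ℤ)) + (A : Set (Fin d → ℤ))) := by
    intro p hp
    induction hp using AddSubmonoid.closure_induction with
    | mem p hp =>
      refine ⟨fun h => AddSubmonoid.subset_closure ?_, fun h => ?_⟩
      · exact Finset.mem_coe.2 (Finset.mem_image_of_mem _ (Finset.mem_filter.2 ⟨hp, h⟩))
      · exact ⟨p.1, Finset.mem_coe.2 (Finset.mem_image_of_mem _ (Finset.mem_filter.2 ⟨hp, h⟩)), 0,
          zero_mem A, add_zero _⟩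
    | zero => exact ⟨fun _ => zero_mem A, fun h => absurd h (by simp)⟩
    | add p q _ _ hp hq =>
      refine ⟨fun h => ?_, fun h => ?_⟩
      · obtain ⟨h1, h2⟩ := Nat.add_eq_zero_iff.1 h
        exact add_mem (hp.1 h1) (hq.1 h2)
      -- One summand has degree one; the other has degree zero and is absorbed into `A`.
      · obtain ⟨h1, h2⟩ | ⟨h1, h2⟩ := Nat.add_eq_one_iff.1 h
        · obtain ⟨f, hf, a, ha, hfa⟩ := hq.2 h2
          refine ⟨f, hf, a + p.1, add_mem ha (hp.1 h1), ?_⟩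
          rw [Prod.fst_add, ← hfa]
          simp only
          abel
        · obtain ⟨f, hf, a, ha, hfa⟩ := hp.2 h1
          refine ⟨f, hf, a + q.1, add_mem ha (hq.1 h2), ?_⟩
          rw [Prod.fst_add, ← hfa]
          simp only
          abel
  refine ⟨A, ⟨_, hA⟩, F, ?_⟩
  ext x
  refine ⟨fun hx => (key _ hx).2 rfl, ?_⟩
  rintro ⟨f, hf, a, ha, rfl⟩
  obtain ⟨⟨y, s⟩, hy, rfl⟩ := Finset.mem_image.1 (Finset.mem_coe.1 hf)
  obtain ⟨hy, rfl : s = 1⟩ := Finset.mem_filter.1 hy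
  simpa using add_mem (AddSubmonoid.subset_closure hy) (hAT a ha)

/-- The integer points of a rational polyhedron in a fixed residue class form a finitely generated
module over an affine semigroup. -/
lemma exists_isFGModuleFor_setOf_le {ι : Type*} [Finite ι] (N : ℕ) (u : Fin d → ℤ)
    (l : ι → ((Fin d → ℤ) →+ ℤ)) (c : ι → ℤ) :
    ∃ A, IsAffineSemigroup A ∧
      IsFGModuleFor A {x | (∀ k, (N : ℤ) ∣ x k - u k) ∧ ∀ i, c i ≤ l i x} := by
  -- Homogenisation: at `((x, s), w, y)`, `f = g` reads `x = s u + N w` and `l i x = s c i + y i`,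
  -- with natural slacks `y`. The slice `s = 1` is the original system.
  let X := ((Fin d → ℤ) × ℕ) × (Fin d → ℤ) × (ι → ℕ)
  let f : X →+ (Fin d → ℤ) × (ι → ℤ) :=
    { toFun := fun p => (p.1.1, fun i => l i p.1.1)
      map_zero' := by ext <;> simp
      map_add' := fun p q => Prod.ext rfl (funext fun i => map_add (l i) p.1.1 q.1.1) }
  let g : X →+ (Fin d → ℤ) × (ι → ℤ) :=
    { toFun := fun p => (fun k => p.1.2 * u k + N * p.2.1 k, fun i => p.1.2 * c i + p.2.2 i)
      map_zero' := by ext <;> simp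
      map_add' := fun p q => by
        refine Prod.ext (funext fun k => ?_) (funext fun i => ?_)
        · change ((p.1.2 + q.1.2 : ℕ) : ℤ) * u k + N * (p.2.1 k + q.2.1 k) =
            p.1.2 * u k + N * p.2.1 k + (q.1.2 * u k + N * q.2.1 k)
          push_cast
          ring
        · change ((p.1.2 + q.1.2 : ℕ) : ℤ) * c i + (p.2.2 i + q.2.2 i : ℕ) =
            p.1.2 * c i + p.2.2 i + (q.1.2 * c i + q.2.2 i)
          push_cast
          ring }
  obtain ⟨A, hA, h⟩ := ((AddMonoidHom.fg_eqLocusM f g).map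
    (AddMonoidHom.fst ((Fin d → ℤ) × ℕ) ((Fin d → ℤ) × (ι → ℕ)))).exists_isFGModuleFor
  refine ⟨A, hA, ?_⟩
  convert! h using 1
  ext x
  have : (x, 1) ∈ (f.eqLocusM g).map
      (AddMonoidHom.fst ((Fin d → ℤ) × ℕ) ((Fin d → ℤ) × (ι → ℕ))) ↔
      ∃ (w : Fin d → ℤ) (y : ι → ℕ), f ((x, 1), w, y) = g ((x, 1), w, y) := by
    constructor
    · rintro ⟨⟨_, w, y⟩, hp, rfl⟩
      exact ⟨w, y, hp⟩
    · rintro ⟨w, y, hp⟩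
      exact ⟨_, hp, rfl⟩
  rw [Set.mem_ofPred_eq, Set.mem_ofPred_eq, this]
  simp only [f, g, AddMonoidHom.coe_mk, ZeroHom.coe_mk, Prod.mk.injEq, funext_iff, Nat.cast_one,
    one_mul]
  constructor
  · rintro ⟨h1, h2⟩
    choose w hw using h1
    refine ⟨w, fun i => (l i x - c i).toNat, fun k => by rw [← hw]; ring, fun i => ?_⟩
    rw [Int.toNat_of_nonneg (sub_nonneg.2 (h2 i))]
    ring
  · rintro ⟨w, y, h1, h2⟩
    exact ⟨fun k => ⟨w k, by rw [h1]; ring⟩, fun i => by rw [h2]; simp⟩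

/-- The signature `σ` takes finitely many values and `W` is a union of its fibres, which serve as
the parts. -/
lemma IsPresburger.nonempty_affineStratification {W : Set (Fin d → ℤ)} (h : IsPresburger W) :
    Nonempty (AffineStratification W) := by
  classical
  obtain ⟨N, hN, H, h⟩ := h
  have : NeZero N := ⟨hN.ne'⟩
  let σ : (Fin d → ℤ) → (Fin d → ZMod N) × (H → Prop) :=
    fun x => (fun k => x k, fun p => p.1.2 ≤ p.1.1 x)
  have hσ : ∀ x y, σ x = σ y ↔
      (∀ k, (N : ℤ) ∣ y k - x k) ∧ ∀ p ∈ H, p.2 ≤ p.1 x ↔ p.2 ≤ p.1 y := fun x y => by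
    simp [σ, funext_iff, ZMod.intCast_eq_intCast_iff_dvd_sub]
  have hcl : ∀ x, ∃ A, IsAffineSemigroup A ∧ IsFGModuleFor A {y | σ x = σ y} := by
    intro x
    obtain ⟨A, hA, hF⟩ := exists_isFGModuleFor_setOf_le N x
      -- By integrality, the failure of `c ≤ l y` is the inequality `1 - c ≤ -l y`.
      (fun p : H => if p.1.2 ≤ p.1.1 x then p.1.1 else -p.1.1)
      (fun p : H => if p.1.2 ≤ p.1.1 x then p.1.2 else 1 - p.1.2)
    refine ⟨A, hA, ?_⟩
    convert! hF using 1
    ext y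
    rw [Set.mem_ofPred_eq, Set.mem_ofPred_eq, hσ]
    refine and_congr_right fun _ => ⟨fun h p => ?_, fun h p hp => ?_⟩
    · have := h p.1 p.2
      split_ifs with hx
      · exact this.1 hx
      · rw [AddMonoidHom.neg_apply]
        have := mt this.2 hx
        omega
    · have := h ⟨p, hp⟩
      simp only at this
      split_ifs at this with hx
      · exact iff_of_true hx this
      · rw [AddMonoidHom.neg_apply] at this
        exact iff_of_false hx (by omega)
  let e := Finite.equivFin (σ '' W)
  choose x hxW hx using fun i : Fin (Nat.card (σ '' W)) => (e.symm i).2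
  choose A hA hF using fun i => hcl (x i)
  refine ⟨⟨_, fun i => {y | σ (x i) = σ y}, A, hA, hF, fun i j hij => ?_, ?_⟩⟩
  · refine Set.disjoint_left.2 fun y hi hj => hij (e.symm.injective (Subtype.ext ?_))
    rw [← hx, ← hx]
    exact hi.trans hj.symm
  · ext y
    simp only [Set.mem_iUnion, Set.mem_ofPred_eq]
    constructor
    · rintro ⟨i, hi⟩
      obtain ⟨h1, h2⟩ := (hσ _ _).1 hi
      exact h _ _ h1 h2 (hxW i)
    · intro hy
      exact ⟨e ⟨σ y, y, hy, rfl⟩, by rw [hx, Equiv.symm_apply_apply]⟩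

theorem theoremt (d : ℕ) (A B : Set (Fin d → ℤ)) (hBA : B ⊆ A)
    (hA : Nonempty (AffineStratification A)) (hB : Nonempty (AffineStratification B)) :
    Nonempty (AffineStratification (A \ B)) := by
  obtain ⟨⟨sA⟩, ⟨sB⟩⟩ := And.intro hA hB
  exact (sA.isPresburger.inter sB.isPresburger.compl).nonempty_affineStratification
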